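/- Let $N\ge 0$ be an integer, $S$ a finite set of states, $A$ a set of actions, and for every $i\in S$ let $A(i)\subseteq A$ be a finite nonempty set of feasible actions. For $0\le n<N$, $i\in S$, $a\in A(i)$ let $p_n(i,a,\cdot)$ be a probability distribution on $S$, let $g_n(i,a,j)\in\mathbb R$ ($j\in S$) be single-stage costs, and let $g_N(i)\in\mathbb R$ ($i\in S$) be terminal costs. A policy is a tuple $\pi=(\pi_0,\dots,\pi_{N-1})$ of maps with $\pi_n(i)\in A(i)$. For $0\le n\le N$, $i\in S$, $a\in A(i)$ define the optimal Q-value $$Q^*_n(i,a)=\min_{\pi}\;E\Big[\sum_{l=n}^{N-1}g_l(s_l,a_l,s_{l+1})+g_N(s_N)\,\Big|\,s_n=i,\ a_n=a\Big],$$ where $a_l=\pi_l(s_l)$ for $n<l<N$, and $s_{l+1}$ has conditional law $p_l(s_l,a_l,\cdot)$ given the past for $n\le l<N$ (so that $Q^*_N(i,a)=g_N(i)$). Let $(a(m))_{m\ge0}$ be deterministic step sizes with $a(m)>0$ for all $m$, $\sum_m a(m)=\infty$ and $\sum_m a(m)^2<\infty$. Let $\eta^m_n(i,a)$ ($m\ge0$,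 $0\le n<N$, $i\in S$, $a\in A(i)$) be $S$-valued random variables on a probability space such that $\eta^m_n(i,a)$ has distribution $p_n(i,a,\cdot)$ and the families $(\eta^m_n(i,a))_{n,i,a}$, $m=0,1,2,\dots$, are mutually independent (no independence within a family is required). Starting from an arbitrary deterministic vector $Q^0=(Q^0_n(i,a))_{0\le n\le N,\,i\in S,\,a\in A(i)}$, define for $m\ge 0$ and all $i\in S$, $a\in A(i)$ $$Q_n^{m+1}(i,a)=Q_n^m(i,a)+a(m)\Big(g_n(i,a,\eta_n^m(i,a))+\min_{b\in A(\eta_n^m(i,a))}Q^m_{n+1}(\eta_n^m(i,a),b)-Q_n^m(i,a)\Big),\quad 0\le n<N,$$ $$Q_N^{m+1}(i,a)=g_N(i).$$ Then, with $\|\cdot\|$ the sup norm and $Q^*=(Q^*_n(i,a))_{0\le n\le N,\,i\in S,\,a\in A(i)}$, (a) $\sup_m\|Q^m\|<\infty$ almost surely, and (b) $Q^m\to Q^*$ as $m\to\infty$ almost surely. -/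

import Mathlib

open MeasureTheory ProbabilityTheory Filter
open scoped Topology

/-- A finite horizon Markov decision problem with `N` decision stages `0, …, N - 1` and terminal
instant `N`, finite state space `S`, action space `A`, and a finite nonempty set `feas i ⊆ A` of
feasible actions in every state `i`. The transition probabilities `p n i a j` and the single-stage
costs `g n i a j` depend on the stage `n`; the terminal cost is `gN`. Values of `p` and `g` at
infeasible actions are never used. -/
structure FiniteHorizonMDP (N : ℕ) (S A : Type*) [Fintype S] where
  feas : S → Finset A
  feas_nonempty : ∀ i, (feas i).Nonempty
  p : Fin N → S → A → S → ℝ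
  p_nonneg : ∀ n i, ∀ a ∈ feas i, ∀ j, 0 ≤ p n i a j
  p_sum : ∀ n i, ∀ a ∈ feas i, ∑ j, p n i a j = 1
  g : Fin N → S → A → S → ℝ
  gN : S → ℝ

namespace FiniteHorizonMDP

variable {N : ℕ} {S A : Type*} [Fintype S]

/-- Vectors `(Q_n(i,a))` indexed by `n = 0, …, N`, `i ∈ S` and `a ∈ A(i)`. The norm that this type
carries is the sup norm. -/
abbrev QVec (M : FiniteHorizonMDP N S A) : Type _ :=
  Fin (N + 1) → (i : S) → M.feas i → ℝ

/-- Policies `π = (π_0, …, π_{N-1})` with `π_n(i) ∈ A(i)`. -/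
abbrev Policy (M : FiniteHorizonMDP N S A) : Type _ :=
  Fin N → (i : S) → M.feas i

/-- The action taken at stage `l` in state `j` when the action at stage `k` is prescribed to be `a`
and all other actions are those of the policy `π`. -/
def action (M : FiniteHorizonMDP N S A) (π : M.Policy) (k : Fin (N + 1)) (a : A)
    (l : Fin N) (j : S) : A :=
  if l.castSucc = k then a else (π l j : A)

/-- Probability of the states `s_{k+1}, …, s_N` given `s_k`, when the action at stage `k` is `a` and
the later actions are those of `π`. -/
def pathProb (M : FiniteHorizonMDP N S A) (π : M.Policy) (k : Fin (N + 1)) (a : A)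
    (s : Fin (N + 1) → S) : ℝ :=
  ∏ l : Fin N with k ≤ l.castSucc, M.p l (s l.castSucc) (M.action π k a l (s l.castSucc)) (s l.succ)

/-- Cost of the stages `k, …, N - 1` and terminal cost, along the states `s_k, …, s_N`, when the
action at stage `k` is `a` and the later actions are those of `π`. -/
def pathCost (M : FiniteHorizonMDP N S A) (π : M.Policy) (k : Fin (N + 1)) (a : A)
    (s : Fin (N + 1) → S) : ℝ :=
  (∑ l : Fin N with k ≤ l.castSucc,
    M.g l (s l.castSucc) (M.action π k a l (s l.castSucc)) (s l.succ)) + M.gN (s (Fin.last N))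

open Classical in
/-- The Q-value of the policy `π` at stage `k`: the expectation
`E[∑_{l=k}^{N-1} g_l(s_l, a_l, s_{l+1}) + g_N(s_N) | s_k = i, a_k = a]` with `a_l = π_l(s_l)` for
`l > k`. It is the finite sum over the possible values of `(s_{k+1}, …, s_N)`; these are encoded as
paths `(s_0, …, s_N)` whose entries up to time `k` are all equal to `i` (the entries before
time `k` are dummies). -/
noncomputable def policyQ (M : FiniteHorizonMDP N S A) (π : M.Policy) (k : Fin (N + 1))
    (i : S) (a : A) : ℝ :=
  ∑ s : Fin (N + 1) → S with ∀ l ≤ k, s l = i, M.pathProb π k a s * M.pathCost π k a s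

/-- The vector `Q*` of optimal Q-values, `Q*_k(i,a) = min_π Q^π_k(i,a)`; the infimum is over a finite
nonempty set. -/
noncomputable def optQ (M : FiniteHorizonMDP N S A) : M.QVec :=
  fun k i a => ⨅ π : M.Policy, M.policyQ π k i a

/-- One synchronous step of finite horizon Q-learning, with step size `t` and next states
`η n i a`: every stage `n < N` and every pair `(i, a)` is updated by
`Q_n(i,a) + t (g_n(i,a,η) + min_{b ∈ A(η)} Q_{n+1}(η,b) - Q_n(i,a))`, and stage `N` is set to the
terminal cost. -/
noncomputable def qStep (M : FiniteHorizonMDP N S A) (t : ℝ)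
    (η : Fin N → (i : S) → M.feas i → S) (Q : M.QVec) : M.QVec :=
  fun n i a => Fin.lastCases (motive := fun _ => ℝ) (M.gN i)
    (fun k : Fin N => Q k.castSucc i a +
      t * (M.g k i a (η k i a) + (⨅ b : M.feas (η k i a), Q k.succ (η k i a) b)
        - Q k.castSucc i a)) n

/-- The Q-learning iterates `Q^0, Q^1, …` with step sizes `α m` and next states `η m n i a`. -/
noncomputable def qIter (M : FiniteHorizonMDP N S A) (α : ℕ → ℝ) (Q₀ : M.QVec)
    (η : ℕ → Fin N → (i : S) → M.feas i → S) : ℕ → M.QVec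
  | 0 => Q₀
  | m + 1 => M.qStep (α m) (η m) (qIter M α Q₀ η m)

end FiniteHorizonMDP

/-- A relaxation recursion with vanishing, non-summable step sizes and vanishing input converges
to zero. -/
theorem tendsto_zero_of_relaxation {α x d : ℕ → ℝ} (hα_pos : ∀ m, 0 < α m)
    (hα_sum : Tendsto (fun n => ∑ m ∈ Finset.range n, α m) atTop atTop)
    (hα_zero : Tendsto α atTop (𝓝 0))
    (hx : ∀ m, x (m + 1) = (1 - α m) * x m + α m * d m)
    (hd : Tendsto d atTop (𝓝 0)) : Tendsto x atTop (𝓝 0) := by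
  rw [Metric.tendsto_atTop]
  intro e he
  have hd' : ∀ᶠ m in atTop, |d m| < e / 2 := by
    simpa using (hd.abs).eventually_lt_const (by simpa using half_pos he)
  have hα' : ∀ᶠ m in atTop, α m < 1 := hα_zero.eventually_lt_const one_pos
  obtain ⟨K, hK⟩ := eventually_atTop.1 (hd'.and hα')
  have key : ∀ m, |x (K + m)| ≤ e / 2 +
      |x K| * Real.exp (-(∑ k ∈ Finset.range (K + m), α k - ∑ k ∈ Finset.range K, α k)) := by
    intro m
    induction m with
    | zero => simp only [add_zero, sub_self, neg_zero, Real.exp_zero]; linarith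
    | succ m ih =>
      obtain ⟨h1, h2⟩ := hK (K + m) (by omega)
      rw [← add_assoc, hx, Finset.sum_range_succ]
      set T := ∑ k ∈ Finset.range (K + m), α k - ∑ k ∈ Finset.range K, α k with hT
      have e1 : Real.exp (-(∑ k ∈ Finset.range (K + m), α k + α (K + m) -
          ∑ k ∈ Finset.range K, α k)) = Real.exp (-α (K + m)) * Real.exp (-T) := by
        rw [← Real.exp_add]; congr 1; rw [hT]; ring
      have e2 : 1 - α (K + m) ≤ Real.exp (-α (K + m)) := by
        linarith [Real.add_one_le_exp (-α (K + m))]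
      have e3 : |(1 - α (K + m)) * x (K + m) + α (K + m) * d (K + m)| ≤
          (1 - α (K + m)) * |x (K + m)| + α (K + m) * |d (K + m)| := by
        refine (abs_add_le _ _).trans ?_
        rw [abs_mul, abs_mul, abs_of_pos (hα_pos _), abs_of_nonneg (by linarith)]
      have e4 : (1 - α (K + m)) * |x (K + m)| ≤
          (1 - α (K + m)) * (e / 2 + |x K| * Real.exp (-T)) :=
        mul_le_mul_of_nonneg_left ih (by linarith)
      have e5 : α (K + m) * |d (K + m)| ≤ α (K + m) * (e / 2) :=
        mul_le_mul_of_nonneg_left h1.le (hα_pos _).le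
      have e6 : (1 - α (K + m)) * (|x K| * Real.exp (-T)) ≤
          Real.exp (-α (K + m)) * (|x K| * Real.exp (-T)) :=
        mul_le_mul_of_nonneg_right e2 (by positivity)
      rw [e1]
      linarith
  have hlim : Tendsto (fun n => |x K| *
      Real.exp (-(∑ k ∈ Finset.range n, α k - ∑ k ∈ Finset.range K, α k))) atTop (𝓝 0) := by
    rw [← mul_zero |x K|]
    refine Tendsto.const_mul _ (Real.tendsto_exp_neg_atTop_nhds_zero.comp ?_)
    exact tendsto_atTop_add_const_right _ _ hα_sum
  obtain ⟨K', hK'⟩ := eventually_atTop.1 (hlim.eventually_lt_const (half_pos he))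
  refine ⟨K + K', fun n hn => ?_⟩
  have h1 := key (n - K)
  rw [show K + (n - K) = n by omega] at h1
  have h2 := hK' n (by omega)
  rw [Real.dist_0_eq_abs]
  linarith

/-- Convergence of a stochastic approximation recursion towards `μ` along a sample path: the input
is `μ`, plus a vanishing perturbation, plus a noise whose weighted series converges. -/
theorem tendsto_of_stochasticApproximation {α x d w : ℕ → ℝ} {μ L : ℝ} (hα_pos : ∀ m, 0 < α m)
    (hα_sum : Tendsto (fun n => ∑ m ∈ Finset.range n, α m) atTop atTop)
    (hα_zero : Tendsto α atTop (𝓝 0))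
    (hx : ∀ m, x (m + 1) = x m + α m * (μ + w m + d m - x m))
    (hd : Tendsto d atTop (𝓝 0))
    (hw : Tendsto (fun n => ∑ m ∈ Finset.range n, α m * w m) atTop (𝓝 L)) :
    Tendsto x atTop (𝓝 μ) := by
  have hW : Tendsto (fun n => ∑ m ∈ Finset.range n, α m * w m - L) atTop (𝓝 0) := by
    simpa using hw.sub_const L
  have hz : Tendsto (fun n => x n - μ - (∑ m ∈ Finset.range n, α m * w m - L)) atTop (𝓝 0) := by
    refine tendsto_zero_of_relaxation hα_pos hα_sum hα_zero
      (d := fun n => d n - (∑ m ∈ Finset.range n, α m * w m - L)) (fun m => ?_)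
      (by simpa using hd.sub hW)
    rw [hx, Finset.sum_range_succ]
    ring
  have := (hz.add hW).add_const μ
  simpa using this

/-- A series of independent centered square integrable random variables with summable variances
converges almost surely. -/
theorem ProbabilityTheory.iIndepFun.ae_exists_tendsto_sum {Ω : Type*} [MeasurableSpace Ω]
    {P : Measure Ω} [IsProbabilityMeasure P] {Y : ℕ → Ω → ℝ} (hY : iIndepFun Y P)
    (hmeas : ∀ m, Measurable (Y m)) (hL2 : ∀ m, MemLp (Y m) 2 P)
    (hmean : ∀ m, P[Y m] = 0) (hvar : Summable fun m => Var[Y m; P]) :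
    ∀ᵐ ω ∂P, ∃ L, Tendsto (fun n => ∑ m ∈ Finset.range n, Y m ω) atTop (𝓝 L) := by
  have hsm : ∀ m, StronglyMeasurable (Y m) := fun m => (hmeas m).stronglyMeasurable
  have hint : ∀ m, Integrable (Y m) P := fun m => (hL2 m).integrable (by norm_num)
  let F : ℕ → Ω → ℝ := fun n => ∑ m ∈ Finset.range (n + 1), Y m
  have hFL2 : ∀ n, MemLp (F n) 2 P := fun n => memLp_finsetSum' _ fun m _ => hL2 m
  have hFint : ∀ n, Integrable (F n) P := fun n => (hFL2 n).integrable (by norm_num)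
  have hmart : Martingale F (Filtration.natural Y hsm) P := by
    refine martingale_of_condExp_sub_eq_zero_nat (fun n => ?_) hFint fun n => ?_
    · refine Finset.stronglyMeasurable_sum _ fun m hm => ?_
      exact (Filtration.stronglyAdapted_natural hsm m).mono
        ((Filtration.natural Y hsm).mono (by simpa [Nat.lt_succ_iff] using hm))
    · have : F (n + 1) - F n = Y (n + 1) := by
        simp only [F]; rw [Finset.sum_range_succ _ (n + 1)]; simp
      rw [this]
      refine (hY.condExp_natural_ae_eq_of_lt hsm n.lt_succ_self).trans ?_
      rw [hmean]; rfl
  have hFvar : ∀ n, ∫ ω, F n ω ^ 2 ∂P ≤ ∑' m, Var[Y m; P] := fun n => by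
    have h0 : P[F n] = 0 := by
      simp only [F, Finset.sum_apply]
      rw [integral_finsetSum _ fun m _ => hint m]
      exact Finset.sum_eq_zero fun m _ => hmean m
    rw [← variance_of_integral_eq_zero (hFint n).aemeasurable h0,
      IndepFun.variance_sum (fun m _ => hL2 m) fun i _ j _ hij => hY.indepFun hij]
    exact hvar.sum_le_tsum _ fun m _ => variance_nonneg _ _
  have hbdd : ∀ n, eLpNorm (F n) 1 P ≤ (1 + ∑' m, Var[Y m; P]).toNNReal := fun n => by
    rw [eLpNorm_one_eq_lintegral_enorm, ← ofReal_integral_norm_eq_lintegral_enorm (hFint n)]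
    refine ENNReal.ofReal_le_ofReal ?_
    have h1 : ∫ ω, ‖F n ω‖ ∂P ≤ ∫ ω, (1 + F n ω ^ 2) ∂P := by
      refine integral_mono (hFint n).norm ((integrable_const _).add (hFL2 n).integrable_sq)
        fun ω => ?_
      simp only [Real.norm_eq_abs]
      nlinarith [sq_nonneg (|F n ω| - 1), sq_abs (F n ω)]
    rw [integral_add (integrable_const _) (hFL2 n).integrable_sq] at h1
    simp only [integral_const, probReal_univ, smul_eq_mul, mul_one] at h1
    linarith [hFvar n]
  filter_upwards [hmart.submartingale.exists_ae_tendsto_of_bdd hbdd] with ω ⟨L, hL⟩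
  refine ⟨L, (tendsto_add_atTop_iff_nat 1).1 ?_⟩
  simpa [F] using hL

namespace FiniteHorizonMDP

variable {N : ℕ} {S A : Type*} [Fintype S]

/-- Optimal Q-values, computed by backward dynamic programming. -/
noncomputable def dpQ (M : FiniteHorizonMDP N S A) : M.QVec :=
  fun k => Fin.reverseInduction (motive := fun _ => (i : S) → M.feas i → ℝ) (fun i _ => M.gN i)
    (fun n V i a => ∑ j, M.p n i a j * (M.g n i a j + ⨅ b : M.feas j, V j b)) k

theorem dpQ_last (M : FiniteHorizonMDP N S A) (i : S) (a : M.feas i) :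
    M.dpQ (Fin.last N) i a = M.gN i := by
  simp [dpQ]

theorem dpQ_castSucc (M : FiniteHorizonMDP N S A) (n : Fin N) (i : S) (a : M.feas i) :
    M.dpQ n.castSucc i a =
      ∑ j, M.p n i a j * (M.g n i a j + ⨅ b : M.feas j, M.dpQ n.succ j b) := by
  simp [dpQ]

open Classical in
/-- Splitting a sum over the paths that are constant up to time `n` by the value at time `n + 1`. -/
theorem sum_paths_castSucc (n : Fin N) (i : S) (f : (Fin (N + 1) → S) → ℝ)
    (hf : ∀ s t : Fin (N + 1) → S, (∀ l, n.castSucc < l → s l = t l) → f s = f t) :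
    ∑ s : Fin (N + 1) → S with ∀ l ≤ n.castSucc, s l = i, f s =
      ∑ j, ∑ s : Fin (N + 1) → S with ∀ l ≤ n.succ, s l = j, f s := by
  rw [← Finset.sum_fiberwise _ (fun s : Fin (N + 1) → S => s n.succ)]
  refine Finset.sum_congr rfl fun j _ => ?_
  refine Finset.sum_bij' (fun s _ l => if l ≤ n.castSucc then j else s l)
    (fun s _ l => if l ≤ n.castSucc then i else s l) ?_ ?_ ?_ ?_ ?_
  · intro s hs
    simp only [Finset.mem_filter, Finset.mem_univ, true_and] at hs ⊢
    intro l hl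
    split_ifs with h
    · rfl
    · have : l = n.succ := by
        simp only [Fin.le_def, Fin.ext_iff, Fin.val_succ, Fin.val_castSucc] at *; omega
      rw [this, hs.2]
  · intro s hs
    simp only [Finset.mem_filter, Finset.mem_univ, true_and] at hs ⊢
    refine ⟨fun l hl => if_pos hl, ?_⟩
    rw [if_neg (not_le.2 (Fin.castSucc_lt_succ (i := n)))]
    exact hs _ le_rfl
  · intro s hs
    simp only [Finset.mem_filter, Finset.mem_univ, true_and] at hs
    funext l
    by_cases h : l ≤ n.castSucc
    · simp [h, hs.1 l h]
    · simp [h]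
  · intro s hs
    simp only [Finset.mem_filter, Finset.mem_univ, true_and] at hs
    funext l
    by_cases h : l ≤ n.castSucc
    · simp [h, hs l (h.trans (Fin.castSucc_lt_succ (i := n)).le)]
    · simp [h]
  · intro s hs
    exact hf _ _ fun l hl => by simp [not_le.2 hl]

theorem filter_castSucc_le (n : Fin N) :
    (Finset.univ.filter fun l : Fin N => n.castSucc ≤ l.castSucc) =
      insert n (Finset.univ.filter fun l : Fin N => n.succ ≤ l.castSucc) := by
  ext l
  simp only [Finset.mem_filter, Finset.mem_univ, true_and, Finset.mem_insert, Fin.le_def,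
    Fin.ext_iff, Fin.val_succ, Fin.val_castSucc]
  omega

theorem notMem_filter_succ_le (n : Fin N) :
    n ∉ Finset.univ.filter fun l : Fin N => n.succ ≤ l.castSucc := by
  simp [Fin.le_def]

/-- Transition probability of the stages `k, …, N - 1` along a path under the decision rules `u`. -/
def rulesProb (M : FiniteHorizonMDP N S A) (u : Fin N → S → A) (k : Fin (N + 1))
    (s : Fin (N + 1) → S) : ℝ :=
  ∏ l : Fin N with k ≤ l.castSucc, M.p l (s l.castSucc) (u l (s l.castSucc)) (s l.succ)

/-- Cost of the stages `k, …, N` along a path under the decision rules `u`. -/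
def rulesCost (M : FiniteHorizonMDP N S A) (u : Fin N → S → A) (k : Fin (N + 1))
    (s : Fin (N + 1) → S) : ℝ :=
  (∑ l : Fin N with k ≤ l.castSucc,
    M.g l (s l.castSucc) (u l (s l.castSucc)) (s l.succ)) + M.gN (s (Fin.last N))

theorem rulesProb_castSucc (M : FiniteHorizonMDP N S A) (u : Fin N → S → A) (n : Fin N)
    (s : Fin (N + 1) → S) :
    M.rulesProb u n.castSucc s =
      M.p n (s n.castSucc) (u n (s n.castSucc)) (s n.succ) * M.rulesProb u n.succ s := by
  rw [rulesProb, filter_castSucc_le, Finset.prod_insert (notMem_filter_succ_le n), rulesProb]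

theorem rulesCost_castSucc (M : FiniteHorizonMDP N S A) (u : Fin N → S → A) (n : Fin N)
    (s : Fin (N + 1) → S) :
    M.rulesCost u n.castSucc s =
      M.g n (s n.castSucc) (u n (s n.castSucc)) (s n.succ) + M.rulesCost u n.succ s := by
  rw [rulesCost, filter_castSucc_le, Finset.sum_insert (notMem_filter_succ_le n), rulesCost,
    add_assoc]

theorem rulesProb_congr (M : FiniteHorizonMDP N S A) {u v : Fin N → S → A} {k : Fin (N + 1)}
    {s t : Fin (N + 1) → S} (hst : ∀ l, k ≤ l → s l = t l)
    (huv : ∀ l : Fin N, k ≤ l.castSucc → u l (t l.castSucc) = v l (t l.castSucc)) :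
    M.rulesProb u k s = M.rulesProb v k t := by
  refine Finset.prod_congr rfl fun l hl => ?_
  have hl' : k ≤ l.castSucc := by simpa using hl
  rw [hst _ hl', hst l.succ (hl'.trans (Fin.castSucc_lt_succ (i := l)).le), huv l hl']

theorem rulesCost_congr (M : FiniteHorizonMDP N S A) {u v : Fin N → S → A} {k : Fin (N + 1)}
    {s t : Fin (N + 1) → S} (hst : ∀ l, k ≤ l → s l = t l)
    (huv : ∀ l : Fin N, k ≤ l.castSucc → u l (t l.castSucc) = v l (t l.castSucc)) :
    M.rulesCost u k s = M.rulesCost v k t := by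
  rw [rulesCost, rulesCost, hst _ (Fin.le_last k)]
  congr 1
  refine Finset.sum_congr rfl fun l hl => ?_
  have hl' : k ≤ l.castSucc := by simpa using hl
  rw [hst _ hl', hst l.succ (hl'.trans (Fin.castSucc_lt_succ (i := l)).le), huv l hl']

open Classical in
/-- Total mass of the paths from state `i` at time `k`. -/
noncomputable def rulesMass (M : FiniteHorizonMDP N S A) (u : Fin N → S → A) (k : Fin (N + 1))
    (i : S) : ℝ :=
  ∑ s : Fin (N + 1) → S with ∀ l ≤ k, s l = i, M.rulesProb u k s

open Classical in
/-- Expected cost of the stages `k, …, N` from state `i` at time `k` under the decision rules `u`. -/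
noncomputable def rulesValue (M : FiniteHorizonMDP N S A) (u : Fin N → S → A) (k : Fin (N + 1))
    (i : S) : ℝ :=
  ∑ s : Fin (N + 1) → S with ∀ l ≤ k, s l = i, M.rulesProb u k s * M.rulesCost u k s

open Classical in
theorem filter_paths_last (i : S) :
    (Finset.univ.filter fun s : Fin (N + 1) → S => ∀ l ≤ Fin.last N, s l = i) = {fun _ => i} := by
  ext s
  simp [Fin.le_last, funext_iff]

theorem filter_last_le : (Finset.univ.filter fun l : Fin N => Fin.last N ≤ l.castSucc) = ∅ := by
  ext l
  simp [Fin.le_def]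

theorem rulesMass_last (M : FiniteHorizonMDP N S A) (u : Fin N → S → A) (i : S) :
    M.rulesMass u (Fin.last N) i = 1 := by
  classical
  rw [rulesMass, filter_paths_last, Finset.sum_singleton, rulesProb, filter_last_le,
    Finset.prod_empty]

theorem rulesValue_last (M : FiniteHorizonMDP N S A) (u : Fin N → S → A) (i : S) :
    M.rulesValue u (Fin.last N) i = M.gN i := by
  classical
  rw [rulesValue, filter_paths_last, Finset.sum_singleton, rulesProb, rulesCost, filter_last_le,
    Finset.prod_empty, Finset.sum_empty, one_mul, zero_add]

theorem rulesMass_castSucc (M : FiniteHorizonMDP N S A) (u : Fin N → S → A) (n : Fin N) (i : S) :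
    M.rulesMass u n.castSucc i = ∑ j, M.p n i (u n i) j * M.rulesMass u n.succ j := by
  classical
  have h1 : M.rulesMass u n.castSucc i = ∑ s : Fin (N + 1) → S with ∀ l ≤ n.castSucc, s l = i,
      M.p n i (u n i) (s n.succ) * M.rulesProb u n.succ s := by
    refine Finset.sum_congr rfl fun s hs => ?_
    rw [rulesProb_castSucc, (Finset.mem_filter.1 hs).2 _ le_rfl]
  rw [h1, sum_paths_castSucc]
  · refine Finset.sum_congr rfl fun j _ => ?_
    rw [rulesMass, Finset.mul_sum]
    refine Finset.sum_congr rfl fun s hs => ?_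
    rw [(Finset.mem_filter.1 hs).2 _ le_rfl]
  · intro s t hst
    rw [hst _ (Fin.castSucc_lt_succ (i := n)), M.rulesProb_congr
      (fun l hl => hst l ((Fin.castSucc_lt_succ (i := n)).trans_le hl)) fun _ _ => rfl]

theorem rulesMass_eq_one (M : FiniteHorizonMDP N S A) (u : Fin N → S → A)
    (hu : ∀ n i, u n i ∈ M.feas i) (k : Fin (N + 1)) : ∀ i, M.rulesMass u k i = 1 := by
  induction k using Fin.reverseInduction with
  | last => exact M.rulesMass_last u
  | cast n ih =>
    intro i
    rw [rulesMass_castSucc]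
    simp only [ih, mul_one, M.p_sum n i _ (hu n i)]

theorem rulesValue_castSucc (M : FiniteHorizonMDP N S A) (u : Fin N → S → A)
    (hu : ∀ n i, u n i ∈ M.feas i) (n : Fin N) (i : S) :
    M.rulesValue u n.castSucc i =
      ∑ j, M.p n i (u n i) j * (M.g n i (u n i) j + M.rulesValue u n.succ j) := by
  classical
  have h1 : M.rulesValue u n.castSucc i = ∑ s : Fin (N + 1) → S with ∀ l ≤ n.castSucc, s l = i,
      M.p n i (u n i) (s n.succ) * (M.g n i (u n i) (s n.succ) * M.rulesProb u n.succ s +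
        M.rulesProb u n.succ s * M.rulesCost u n.succ s) := by
    refine Finset.sum_congr rfl fun s hs => ?_
    rw [rulesProb_castSucc, rulesCost_castSucc, (Finset.mem_filter.1 hs).2 _ le_rfl]
    ring
  rw [h1, sum_paths_castSucc]
  · refine Finset.sum_congr rfl fun j _ => ?_
    have hm : M.g n i (u n i) j = M.g n i (u n i) j * M.rulesMass u n.succ j := by
      rw [M.rulesMass_eq_one u hu, mul_one]
    rw [hm, rulesMass, rulesValue, Finset.mul_sum, ← Finset.sum_add_distrib, Finset.mul_sum]
    refine Finset.sum_congr rfl fun s hs => ?_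
    rw [(Finset.mem_filter.1 hs).2 _ le_rfl]
  · intro s t hst
    have hst' : ∀ l, n.succ ≤ l → s l = t l :=
      fun l hl => hst l ((Fin.castSucc_lt_succ (i := n)).trans_le hl)
    rw [hst' _ le_rfl, M.rulesProb_congr hst' fun _ _ => rfl,
      M.rulesCost_congr hst' fun _ _ => rfl]

theorem rulesValue_congr (M : FiniteHorizonMDP N S A) {u v : Fin N → S → A} {k : Fin (N + 1)}
    {i : S} (h : ∀ l : Fin N, k < l.castSucc → u l = v l)
    (h' : ∀ l : Fin N, k = l.castSucc → u l i = v l i) :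
    M.rulesValue u k i = M.rulesValue v k i := by
  classical
  refine Finset.sum_congr rfl fun s hs => ?_
  have huv : ∀ l : Fin N, k ≤ l.castSucc → u l (s l.castSucc) = v l (s l.castSucc) := by
    intro l hl
    rcases hl.lt_or_eq with hl | hl
    · rw [h l hl]
    · rw [(Finset.mem_filter.1 hs).2 _ hl.ge, h' l hl]
  rw [M.rulesProb_congr (fun _ _ => rfl) huv, M.rulesCost_congr (fun _ _ => rfl) huv]

open Classical in
theorem policyQ_eq_rulesValue (M : FiniteHorizonMDP N S A) (π : M.Policy) (k : Fin (N + 1))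
    (i : S) (a : A) :
    M.policyQ π k i a = M.rulesValue
      (fun l j => if l.castSucc = k ∧ j = i then a else (π l j : A)) k i := by
  have h : M.policyQ π k i a = M.rulesValue (M.action π k a) k i := rfl
  rw [h]
  refine M.rulesValue_congr (fun l hl => ?_) fun l hl => ?_
  · funext j
    simp [action, hl.ne']
  · simp [action, hl]

theorem policyQ_last (M : FiniteHorizonMDP N S A) (π : M.Policy) (i : S) (a : A) :
    M.policyQ π (Fin.last N) i a = M.gN i := by
  rw [policyQ_eq_rulesValue, rulesValue_last]

/-- The policy evaluation equation. -/
theorem policyQ_castSucc (M : FiniteHorizonMDP N S A) (π : M.Policy) (n : Fin N) (i : S)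
    (a : M.feas i) :
    M.policyQ π n.castSucc i a = ∑ j, M.p n i a j *
      (M.g n i a j + M.rulesValue (fun l j => (π l j : A)) n.succ j) := by
  classical
  rw [policyQ_eq_rulesValue, rulesValue_castSucc]
  · simp only [and_self, if_true]
    refine Finset.sum_congr rfl fun j _ => ?_
    congr 2
    refine M.rulesValue_congr (fun l hl => ?_) fun l hl => ?_
    · funext j
      have : l ≠ n := by
        rintro rfl
        exact absurd hl (by simp [Fin.lt_def])
      simp [this]
    · have : l ≠ n := by
        rintro rfl
        simp [Fin.ext_iff] at hl
      simp [this]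
  · intro l j
    split_ifs with h
    · rw [h.2]; exact a.2
    · exact (π l j).2

theorem rulesValue_policy_castSucc (M : FiniteHorizonMDP N S A) (π : M.Policy) (n : Fin N)
    (i : S) :
    M.rulesValue (fun l j => (π l j : A)) n.castSucc i = M.policyQ π n.castSucc i (π n i) := by
  rw [policyQ_castSucc, rulesValue_castSucc _ _ fun l j => (π l j).2]

instance (M : FiniteHorizonMDP N S A) (i : S) : Nonempty (M.feas i) :=
  (M.feas_nonempty i).to_subtype

theorem iInf_dpQ_le_rulesValue (M : FiniteHorizonMDP N S A) (π : M.Policy) (k : Fin (N + 1)) :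
    ∀ i, ⨅ b : M.feas i, M.dpQ k i b ≤ M.rulesValue (fun l j => (π l j : A)) k i := by
  induction k using Fin.reverseInduction with
  | last => intro i; simp [dpQ_last, rulesValue_last]
  | cast n ih =>
    intro i
    refine (ciInf_le (Set.finite_range _).bddBelow (π n i)).trans ?_
    rw [rulesValue_policy_castSucc, policyQ_castSucc, dpQ_castSucc]
    gcongr with j
    · exact M.p_nonneg n i _ (π n i).2 j
    · exact ih j

theorem exists_policy_rulesValue_eq_iInf_dpQ (M : FiniteHorizonMDP N S A) :
    ∃ π : M.Policy, ∀ (k : Fin (N + 1)) (i : S),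
      M.rulesValue (fun l j => (π l j : A)) k i = ⨅ b : M.feas i, M.dpQ k i b := by
  choose π hπ using fun (n : Fin N) (i : S) =>
    exists_eq_ciInf_of_finite (f := fun b : M.feas i => M.dpQ n.castSucc i b)
  refine ⟨π, fun k => ?_⟩
  induction k using Fin.reverseInduction with
  | last => intro i; simp [dpQ_last, rulesValue_last]
  | cast n ih =>
    intro i
    rw [← hπ, rulesValue_policy_castSucc, policyQ_castSucc, dpQ_castSucc]
    simp only [ih]

/-- Dynamic programming computes the optimal Q-values. -/
theorem optQ_eq_dpQ (M : FiniteHorizonMDP N S A) : M.optQ = M.dpQ := by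
  funext k i a
  obtain ⟨π₀, hπ₀⟩ := M.exists_policy_rulesValue_eq_iInf_dpQ
  have hne : Nonempty M.Policy := ⟨π₀⟩
  have hle : ∀ π : M.Policy, M.dpQ k i a ≤ M.policyQ π k i a := by
    intro π
    induction k using Fin.lastCases with
    | last => rw [dpQ_last, policyQ_last]
    | cast n =>
      rw [dpQ_castSucc, policyQ_castSucc]
      gcongr with j
      · exact M.p_nonneg n i _ a.2 j
      · exact M.iInf_dpQ_le_rulesValue π n.succ j
  have heq : M.policyQ π₀ k i a = M.dpQ k i a := by
    induction k using Fin.lastCases with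
    | last => rw [dpQ_last, policyQ_last]
    | cast n => simp only [dpQ_castSucc, policyQ_castSucc, hπ₀]
  refine le_antisymm ?_ (le_ciInf hle)
  rw [← heq]
  exact ciInf_le ⟨M.dpQ k i a, by rintro _ ⟨π, rfl⟩; exact hle π⟩ π₀

end FiniteHorizonMDP

/-- The minimum of finitely many convergent sequences converges to the minimum of the limits. -/
theorem tendsto_ciInf_of_finite {ι β : Type*} [Finite ι] [Nonempty ι] {l : Filter β}
    {f : β → ι → ℝ} {c : ι → ℝ} (h : ∀ i, Tendsto (fun x => f x i) l (𝓝 (c i))) :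
    Tendsto (fun x => ⨅ i, f x i) l (𝓝 (⨅ i, c i)) := by
  cases nonempty_fintype ι
  simp only [← Finset.inf'_univ_eq_ciInf]
  exact Tendsto.finset_inf'_nhds_apply _ fun i _ => h i

/-- If finitely many families of sequences tend to zero, so does every selection from them. -/
theorem tendsto_zero_of_selection {S : Type*} [Fintype S] {d : S → ℕ → ℝ}
    (h : ∀ j, Tendsto (d j) atTop (𝓝 0)) (σ : ℕ → S) :
    Tendsto (fun m => d (σ m) m) atTop (𝓝 0) := by
  have hsum : Tendsto (fun m => ∑ j, |d j m|) atTop (𝓝 0) := by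
    simpa using tendsto_finsetSum Finset.univ fun j _ => (h j).abs
  refine squeeze_zero_norm (fun m => ?_) hsum
  exact Finset.single_le_sum (f := fun j => |d j m|) (fun _ _ => abs_nonneg _)
    (Finset.mem_univ (σ m))

/-- The step-size weighted series of centered i.i.d. samples of a function on a finite set
converges almost surely. -/
theorem ae_exists_tendsto_sum_mul_centered {S Ω : Type*} [Fintype S] [MeasurableSpace S]
    [MeasurableSingletonClass S] [MeasurableSpace Ω] {P : Measure Ω} [IsProbabilityMeasure P]
    {α : ℕ → ℝ} (hα_sq : Summable fun m => α m ^ 2) {X : ℕ → Ω → S}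
    (hX : ∀ m, Measurable (X m)) (hindep : iIndepFun X P) {q : S → ℝ}
    (hlaw : ∀ m j, P.real {ω | X m ω = j} = q j) (c : S → ℝ) :
    ∀ᵐ ω ∂P, ∃ L, Tendsto (fun n => ∑ m ∈ Finset.range n, α m * (c (X m ω) - ∑ j, q j * c j))
      atTop (𝓝 L) := by
  have hexp : ∀ (f : S → ℝ) (m : ℕ), ∫ ω, f (X m ω) ∂P = ∑ j, q j * f j := by
    intro f m
    rw [← integral_map (hX m).aemeasurable (measurable_of_finite f).aestronglyMeasurable,
      integral_fintype (Integrable.of_finite)]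
    refine Finset.sum_congr rfl fun j _ => ?_
    rw [map_measureReal_apply (hX m) (measurableSet_singleton j), smul_eq_mul, ← hlaw m j]
    rfl
  set μ := ∑ j, q j * c j with hμ
  have hmeas : ∀ m, Measurable fun ω => α m * (c (X m ω) - μ) := fun m =>
    (measurable_of_finite fun j => α m * (c j - μ)).comp (hX m)
  have hL2 : ∀ m, MemLp (fun ω => α m * (c (X m ω) - μ)) 2 P := fun m => by
    refine MemLp.of_bound (hmeas m).aestronglyMeasurable (∑ j, ‖α m * (c j - μ)‖)
      (Eventually.of_forall fun ω => ?_)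
    exact Finset.single_le_sum (f := fun j => ‖α m * (c j - μ)‖) (fun _ _ => norm_nonneg _)
      (Finset.mem_univ (X m ω))
  have hmean : ∀ m, ∫ ω, α m * (c (X m ω) - μ) ∂P = 0 := fun m => by
    have hint : Integrable (fun ω => c (X m ω)) P :=
      (Integrable.of_finite (μ := P.map (X m)) (f := c)).comp_measurable (hX m)
    rw [integral_const_mul, integral_sub hint (integrable_const _), hexp c m]
    simp [hμ]
  refine ProbabilityTheory.iIndepFun.ae_exists_tendsto_sum
    (hindep.comp (fun m j => α m * (c j - μ)) fun m => measurable_of_finite _) hmeas hL2 hmean ?_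
  have hvar : ∀ m, Var[fun ω => α m * (c (X m ω) - μ); P] =
      α m ^ 2 * ∑ j, q j * (c j - μ) ^ 2 := fun m => by
    rw [variance_of_integral_eq_zero (hmeas m).aemeasurable (hmean m)]
    simp only [mul_pow]
    rw [integral_const_mul, hexp (fun j => (c j - μ) ^ 2) m]
  exact (hα_sq.mul_right _).congr fun m => (hvar m).symm

namespace FiniteHorizonMDP

variable {N : ℕ} {S A : Type*} [Fintype S]

theorem qIter_succ_last (M : FiniteHorizonMDP N S A) (α : ℕ → ℝ) (Q₀ : M.QVec)
    (η : ℕ → Fin N → (i : S) → M.feas i → S) (m : ℕ) (i : S) (a : M.feas i) :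
    M.qIter α Q₀ η (m + 1) (Fin.last N) i a = M.gN i := by
  simp [qIter, qStep]

theorem qIter_succ_castSucc (M : FiniteHorizonMDP N S A) (α : ℕ → ℝ) (Q₀ : M.QVec)
    (η : ℕ → Fin N → (i : S) → M.feas i → S) (m : ℕ) (n : Fin N) (i : S) (a : M.feas i) :
    M.qIter α Q₀ η (m + 1) n.castSucc i a = M.qIter α Q₀ η m n.castSucc i a +
      α m * (M.g n i a (η m n i a) +
        (⨅ b : M.feas (η m n i a), M.qIter α Q₀ η m n.succ (η m n i a) b) -
        M.qIter α Q₀ η m n.castSucc i a) := by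
  simp [qIter, qStep]

/-- Q-learning converges along every sample path for which the weighted noise series converge. -/
theorem tendsto_qIter_dpQ (M : FiniteHorizonMDP N S A) {α : ℕ → ℝ} (hα_pos : ∀ m, 0 < α m)
    (hα_sum : Tendsto (fun n => ∑ m ∈ Finset.range n, α m) atTop atTop)
    (hα_zero : Tendsto α atTop (𝓝 0)) (Q₀ : M.QVec)
    (η : ℕ → Fin N → (i : S) → M.feas i → S)
    (hη : ∀ (n : Fin N) (i : S) (a : M.feas i), ∃ L, Tendsto (fun k => ∑ m ∈ Finset.range k, α m *
      ((M.g n i a (η m n i a) + ⨅ b : M.feas (η m n i a), M.dpQ n.succ (η m n i a) b) -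
        ∑ j, M.p n i a j * (M.g n i a j + ⨅ b : M.feas j, M.dpQ n.succ j b))) atTop (𝓝 L)) :
    Tendsto (M.qIter α Q₀ η) atTop (𝓝 M.dpQ) := by
  suffices h : ∀ (k : Fin (N + 1)) (i : S) (a : M.feas i),
      Tendsto (fun m => M.qIter α Q₀ η m k i a) atTop (𝓝 (M.dpQ k i a)) from
    tendsto_pi_nhds.2 fun k => tendsto_pi_nhds.2 fun i => tendsto_pi_nhds.2 fun a => h k i a
  intro k
  induction k using Fin.reverseInduction with
  | last =>
    intro i a
    refine (tendsto_add_atTop_iff_nat 1).1 ?_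
    simp only [qIter_succ_last, dpQ_last]
    exact tendsto_const_nhds
  | cast n ih =>
    intro i a
    obtain ⟨L, hL⟩ := hη n i a
    have hmin : ∀ j, Tendsto (fun m => (⨅ b : M.feas j, M.qIter α Q₀ η m n.succ j b) -
        ⨅ b : M.feas j, M.dpQ n.succ j b) atTop (𝓝 0) := fun j => by
      simpa using (tendsto_ciInf_of_finite fun b => ih j b).sub_const
        (⨅ b : M.feas j, M.dpQ n.succ j b)
    rw [dpQ_castSucc]
    refine tendsto_of_stochasticApproximation hα_pos hα_sum hα_zero (fun m => ?_)
      (tendsto_zero_of_selection hmin fun m => η m n i a) hL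
    rw [qIter_succ_castSucc]
    ring

end FiniteHorizonMDP

theorem mainTheorem1 {N : ℕ} {S A : Type*} [Fintype S] [MeasurableSpace S]
    [MeasurableSingletonClass S] (M : FiniteHorizonMDP N S A)
    (α : ℕ → ℝ) (hα_pos : ∀ m, 0 < α m)
    (hα_sum : Tendsto (fun n => ∑ m ∈ Finset.range n, α m) atTop atTop)
    (hα_sq : Summable (fun m => α m ^ 2))
    {Ω : Type*} [MeasurableSpace Ω] (P : Measure Ω) [IsProbabilityMeasure P]
    (η : ℕ → Fin N → (i : S) → M.feas i → Ω → S)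
    (hη_meas : ∀ m n i a, Measurable (η m n i a))
    (hη_law : ∀ m n i a j, P.real {ω | η m n i a ω = j} = M.p n i a j)
    (hη_indep : iIndepFun (fun m ω n i a => η m n i a ω) P)
    (Q₀ : M.QVec) :
    (∀ᵐ ω ∂P, BddAbove (Set.range fun m => ‖M.qIter α Q₀ (fun m n i a => η m n i a ω) m‖)) ∧
    (∀ᵐ ω ∂P, Tendsto (fun m => M.qIter α Q₀ (fun m n i a => η m n i a ω) m) atTop
      (𝓝 M.optQ)) := by
  have hα_zero : Tendsto α atTop (𝓝 0) := by
    have h := (hα_sq.tendsto_atTop_zero).sqrt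
    simpa [Real.sqrt_sq (hα_pos _).le] using h
  have hnoise : ∀ᵐ ω ∂P, ∀ (n : Fin N) (i : S) (a : M.feas i), ∃ L,
      Tendsto (fun k => ∑ m ∈ Finset.range k, α m * ((M.g n i a (η m n i a ω) +
        ⨅ b : M.feas (η m n i a ω), M.dpQ n.succ (η m n i a ω) b) -
        ∑ j, M.p n i a j * (M.g n i a j + ⨅ b : M.feas j, M.dpQ n.succ j b))) atTop (𝓝 L) := by
    simp only [ae_all_iff]
    intro n i a
    refine ae_exists_tendsto_sum_mul_centered hα_sq (X := fun m => η m n i a)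
      (fun m => hη_meas m n i a) ?_ (fun m j => hη_law m n i a j)
      fun j => M.g n i a j + ⨅ b : M.feas j, M.dpQ n.succ j b
    exact hη_indep.comp (fun _ f => f n i a) fun _ => by fun_prop
  have hlim : ∀ᵐ ω ∂P, Tendsto (fun m => M.qIter α Q₀ (fun m n i a => η m n i a ω) m) atTop
      (𝓝 M.optQ) := by
    filter_upwards [hnoise] with ω hω
    rw [M.optQ_eq_dpQ]
    exact M.tendsto_qIter_dpQ hα_pos hα_sum hα_zero Q₀ _ hω
  refine ⟨?_, hlim⟩
  filter_upwards [hlim] with ω hω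
  exact hω.norm.bddAbove_range
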